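/- Let $n\ge 3$, $[n]=\{1,\dots,n\}$ and $D_n=\{(i,j): 1\le i<j\le n\}$. A collection of points $p_1,\dots,p_n\in\mathbb{R}^d$ induces a relation $\le$ on $D_n$ if, for all $(i,j),(k,l)\in D_n$, one has $(i,j)\le(k,l)$ if and only if $\|p_i-p_j\|\le\|p_k-p_l\|$. A total preorder is a reflexive, transitive relation in which any two elements are comparable; a linear order is an antisymmetric total preorder. Then: 1. The least $d\in\mathbb{N}$ such that every linear order on $D_n$ is induced by some $n$ pairwise distinct points of $\mathbb{R}^d$ is $d=n-2$. 2. The least $d\in\mathbb{N}$ such that every total preorder on $D_n$ is induced by some $n$ pairwise distinct points of $\mathbb{R}^d$ is $d=n-1$. Both statements also hold with the same values of $d$ if the points are required to be in general position, that is, pairwise distinct and such that any at most $d+1$ of them are affinely independent. -/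

import Mathlib

/-- The pairs `(i, j)` with `i < j` of an `n`-element index set. -/
abbrev DistPair (n : ℕ) : Type := {e : Fin n × Fin n // e.1 < e.2}

/-- The distance of the two points indexed by a pair. -/
noncomputable def pairDist {n d : ℕ} (p : Fin n → EuclideanSpace ℝ (Fin d)) (e : DistPair n) : ℝ :=
  dist (p e.1.1) (p e.1.2)

/-- A relation on the pairs is induced by the point collection `p` when it is exactly the
comparison of pairwise distances. -/
def Induces {n d : ℕ} (p : Fin n → EuclideanSpace ℝ (Fin d))
    (r : DistPair n → DistPair n → Prop) : Prop :=
  ∀ e f : DistPair n, r e f ↔ pairDist p e ≤ pairDist p f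

/-- Points of `ℝ^d` in general position: they are pairwise distinct, and any at most `d + 1`
of them are affinely independent. -/
def InGeneralPosition {n d : ℕ} (p : Fin n → EuclideanSpace ℝ (Fin d)) : Prop :=
  Function.Injective p ∧
    ∀ s : Finset (Fin n), s.card ≤ d + 1 → AffineIndependent ℝ (fun i : s => p i)

/-!
Write `D` for the matrix of squared distances of `n` points `p i`. On vectors `x` with `∑ x i = 0`
the form `xᵀ D x` equals `-2 ‖∑ x i • p i‖²` (`quadForm_sqDist`), so it is nonpositive and vanishes
exactly on the affine dependencies of the points.

*Lower bound for linear orders.* The order `nestedOrder` forces dimension `n - 2`. It makes `D` a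
nested matrix (`IsNested`), and the claim is that the form of a nested matrix, when nonpositive on
sum-zero vectors, is degenerate in at most one direction; `n` points of `ℝ^d` with `d + 2 < n` have
at least two independent dependencies, one of them with first coefficient zero. The proof of the
claim is a Perron–Frobenius argument on a nonconvex cone, that of the vectors changing sign at most
once, from plus to minus. If the form is nonpositive on the cone and vanishes at some `x ≠ 0` in it,
then `x` is interior to the cone (`IsNested.strictlySwitchesSign`): otherwise moving `x` within the
cone along some `e a - e b` would increase the form, because comparing rows `a` and `b` of `D`
gives `(D x) b < (D x) a`. Hence a maximizer of the Rayleigh quotient on the cone is an interior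
local maximum, and therefore a global one (`IsNested.quadForm_nonpos`); so, once the form is
degenerate, it is degenerate along some `x` of the cone. Were it degenerate along a further `y` with
`y 0 = 0`, the line `x + ℝ y` could never leave the cone, because its points in the cone are
interior. Then `y` would lie in the cone too, hence in its interior, contradicting `y 0 = 0`
(`IsNested.apply_zero_ne_zero`).

*Lower bound for preorders.* The preorder in which all pairs are equivalent is induced by
equidistant points only, and these are affinely independent.

*Upper bounds.* By the inverse function theorem all small changes of the squared distances can be
realized near a configuration without a self-stress (`exists_perturbation`). The rows of a stress
matrix are affine dependencies. A regular simplex has none, so every preorder on the pairs is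
realized near it. The bipyramid over a regular simplex has a single dependency up to scaling, with
no zero coefficient, so it has no stress that ignores the pair of apexes. That pair is strictly the
farthest and serves as the greatest element of the linear order, while all other distances are
equal and can be perturbed freely.
-/

open Matrix

/-! ### Vectors with one sign change -/

/-- `x` changes sign at most once, from nonnegative to nonpositive. -/
def SwitchesSign {n : ℕ} (x : Fin n → ℝ) : Prop :=
  ∀ i j, i < j → 0 ≤ x i ∨ x j ≤ 0

/-- `x` is positive, then possibly zero at a single place, then negative. This is an open
condition, and it strengthens `SwitchesSign`. -/
def StrictlySwitchesSign {n : ℕ} (x : Fin n → ℝ) : Prop :=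
  ∀ i j, i < j → 0 < x i ∨ x j < 0

theorem StrictlySwitchesSign.switchesSign {n : ℕ} {x : Fin n → ℝ} (h : StrictlySwitchesSign x) :
    SwitchesSign x :=
  fun i j hij => (h i j hij).imp le_of_lt le_of_lt

theorem isClosed_setOf_switchesSign (n : ℕ) : IsClosed {x : Fin n → ℝ | SwitchesSign x} := by
  simp only [SwitchesSign, Set.ofPred_forall, Set.ofPred_or]
  refine isClosed_iInter fun i => isClosed_iInter fun j => isClosed_iInter fun _ => ?_
  exact (isClosed_le continuous_const (continuous_apply i)).union
    (isClosed_le (continuous_apply j) continuous_const)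

theorem isOpen_setOf_strictlySwitchesSign (n : ℕ) :
    IsOpen {x : Fin n → ℝ | StrictlySwitchesSign x} := by
  simp only [StrictlySwitchesSign, Set.ofPred_forall, Set.ofPred_or]
  refine isOpen_iInter_of_finite fun i => isOpen_iInter_of_finite fun j =>
    isOpen_iInter_of_finite fun _ => ?_
  exact (isOpen_lt continuous_const (continuous_apply i)).union
    (isOpen_lt (continuous_apply j) continuous_const)

theorem exists_pos_and_neg {n : ℕ} {x : Fin n → ℝ} (hx : x ≠ 0) (hsum : ∑ i, x i = 0) :
    (∃ i, 0 < x i) ∧ ∃ i, x i < 0 := by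
  obtain ⟨i, hi⟩ := Function.ne_iff.1 hx
  constructor
  · by_contra! h
    exact hi ((Finset.sum_eq_zero_iff_of_nonpos fun i _ => h i).1 hsum i (Finset.mem_univ i))
  · by_contra! h
    exact hi ((Finset.sum_eq_zero_iff_of_nonneg fun i _ => h i).1 hsum i (Finset.mem_univ i))

theorem StrictlySwitchesSign.pos_zero {n : ℕ} [NeZero n] {x : Fin n → ℝ}
    (h : StrictlySwitchesSign x) (hx : x ≠ 0) (hsum : ∑ i, x i = 0) : 0 < x 0 := by
  obtain ⟨⟨i, hi⟩, -⟩ := exists_pos_and_neg hx hsum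
  rcases eq_or_ne i 0 with rfl | h0
  · exact hi
  · exact (h 0 i (Fin.pos_iff_ne_zero.2 h0)).resolve_right hi.le.not_gt

/-! ### Nested matrices -/

/-- A symmetric hollow matrix whose entries above the diagonal decrease from one column to the
next, and increase down each column. The squared distances of points that induce the order
`nestedOrder` form such a matrix. -/
structure IsNested {n : ℕ} (D : Matrix (Fin n) (Fin n) ℝ) : Prop where
  symm : ∀ i j, D i j = D j i
  diag : ∀ i, D i i = 0
  block : ∀ i j k l, i < j → k < l → j < l → D k l < D i j
  within : ∀ i k j, i < k → k < j → D i j < D k j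

/-- The vector with entry `1` at `a` and `-1` at `b`. -/
def edgeVec {n : ℕ} (a b : Fin n) : Fin n → ℝ := Pi.single a 1 - Pi.single b 1

theorem sum_edgeVec {n : ℕ} (a b : Fin n) : ∑ i, edgeVec a b i = 0 := by
  simp [edgeVec]

theorem dotProduct_mulVec_comm {n : ℕ} {D : Matrix (Fin n) (Fin n) ℝ}
    (hD : ∀ i j, D i j = D j i) (x y : Fin n → ℝ) : x ⬝ᵥ D *ᵥ y = y ⬝ᵥ D *ᵥ x := by
  have : Dᵀ = D := by ext i j; exact hD j i
  rw [dotProduct_mulVec, ← mulVec_transpose, this, dotProduct_comm]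

theorem switchesSign_edgeVec {n : ℕ} {a b : Fin n} (hab : a < b) :
    SwitchesSign (edgeVec a b) := by
  intro i j hij
  simp only [edgeVec, Pi.sub_apply, Pi.single_apply]
  by_cases hi : i = b
  · have : j ≠ a := by rintro rfl; exact absurd (hab.trans (hi ▸ hij)) (lt_irrefl _)
    right
    rw [if_neg this]
    split_ifs <;> norm_num
  · left
    split_ifs <;> norm_num

theorem edgeVec_dotProduct {n : ℕ} (a b : Fin n) (v : Fin n → ℝ) :
    edgeVec a b ⬝ᵥ v = v a - v b := by
  simp [edgeVec, sub_dotProduct]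

theorem quadForm_add_smul {n : ℕ} {D : Matrix (Fin n) (Fin n) ℝ}
    (hD : ∀ i j, D i j = D j i) (x y : Fin n → ℝ) (t : ℝ) :
    (x + t • y) ⬝ᵥ D *ᵥ (x + t • y) =
      x ⬝ᵥ D *ᵥ x + 2 * t * (y ⬝ᵥ D *ᵥ x) + t ^ 2 * (y ⬝ᵥ D *ᵥ y) := by
  simp only [mulVec_add, mulVec_smul, dotProduct_add, add_dotProduct, dotProduct_smul,
    smul_dotProduct, smul_eq_mul, dotProduct_mulVec_comm hD x y]
  ring

/-- If moving from a zero `x` of the form along `edgeVec a b` stays in a region where the form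
is nonpositive, then the derivative of the form along `edgeVec a b` is nonpositive. -/
theorem mulVec_apply_le_of_forall_quadForm_nonpos {n : ℕ} {D : Matrix (Fin n) (Fin n) ℝ}
    (hD : ∀ i j, D i j = D j i) {x : Fin n → ℝ} (hx : x ⬝ᵥ D *ᵥ x = 0) {a b : Fin n}
    (h : ∀ t : ℝ, 0 < t →
      (x + t • edgeVec a b) ⬝ᵥ D *ᵥ (x + t • edgeVec a b) ≤ 0) :
    (D *ᵥ x) a ≤ (D *ᵥ x) b := by
  by_contra! hlt
  set A := (D *ᵥ x) a - (D *ᵥ x) b with hA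
  have hA0 : 0 < A := sub_pos.2 hlt
  set B := edgeVec a b ⬝ᵥ D *ᵥ edgeVec a b
  have key : ∀ t : ℝ, 0 < t → 2 * t * A + t ^ 2 * B ≤ 0 := fun t ht => by
    have := h t ht
    rwa [quadForm_add_smul hD, hx, edgeVec_dotProduct, zero_add] at this
  have ht : 0 < A / (|B| + 1) := by positivity
  have h1 := key _ ht
  have h2 : A / (|B| + 1) * B ≥ -A := by
    rw [ge_iff_le, div_mul_eq_mul_div, le_div_iff₀ (by positivity)]
    nlinarith [neg_abs_le B]
  have h3 : 2 * A + A / (|B| + 1) * B ≤ 0 := by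
    by_contra! h4
    nlinarith [mul_pos ht h4]
  linarith

/-- The comparison of two rows of a nested matrix along a vector that vanishes at `k`, is
nonnegative before `z` and nonpositive after. -/
theorem IsNested.mulVec_lt_of_eq_zero {n : ℕ} {D : Matrix (Fin n) (Fin n) ℝ} (hD : IsNested D)
    (hpos : ∀ i j, 0 ≤ D i j) {x : Fin n → ℝ} (hx : x ≠ 0) (hsum : ∑ i, x i = 0) {k z : Fin n}
    (hkz : k < z) (hk : x k = 0) (hz : 0 ≤ x z) (hlt : ∀ l, l < z → 0 ≤ x l)
    (hgt : ∀ l, z < l → x l ≤ 0) : (D *ᵥ x) z < (D *ᵥ x) k := by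
  obtain ⟨-, w, hw⟩ := exists_pos_and_neg hx hsum
  have hzw : z < w := by
    by_contra! h
    rcases h.lt_or_eq with h | rfl
    · exact (hlt w h).not_gt hw
    · exact hz.not_gt hw
  have hterm : ∀ l, D z l * x l ≤ D k l * x l := fun l => by
    rcases lt_trichotomy l k with h | rfl | h
    · refine mul_le_mul_of_nonneg_right ?_ (hlt l (h.trans hkz))
      rw [hD.symm z, hD.symm k]
      exact (hD.block _ _ _ _ h (h.trans hkz) hkz).le
    · simp [hk]
    · rcases lt_trichotomy l z with h' | rfl | h'
      · refine mul_le_mul_of_nonneg_right ?_ (hlt l h')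
        rw [hD.symm z]
        exact (hD.block _ _ _ _ h h' h').le
      · rw [hD.diag, zero_mul]
        exact mul_nonneg (hpos _ _) hz
      · exact mul_le_mul_of_nonpos_right (hD.within _ _ _ hkz h').le (hgt l h')
  exact Finset.sum_lt_sum (fun l _ => hterm l)
    ⟨w, Finset.mem_univ w, mul_lt_mul_of_neg_right (hD.within _ _ _ hkz hzw) hw⟩

/-- The comparison of two rows of a nested matrix along a vector that is nonnegative before `y`,
negative at `y`, nonpositive afterwards and zero at some `k > y`. -/
theorem IsNested.mulVec_lt_of_neg {n : ℕ} [NeZero n] {D : Matrix (Fin n) (Fin n) ℝ}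
    (hD : IsNested D) (hpos : ∀ i j, 0 ≤ D i j) {x : Fin n → ℝ} (hx : x ≠ 0)
    (hsum : ∑ i, x i = 0) {y k : Fin n} (hyk : y < k) (hk : x k = 0) (hy : x y < 0)
    (hlt : ∀ l, l < y → 0 ≤ x l) (hgt : ∀ l, y < l → x l ≤ 0) :
    (D *ᵥ x) k < (D *ᵥ x) y := by
  obtain ⟨⟨w, hw⟩, -⟩ := exists_pos_and_neg hx hsum
  have hwy : w < y := by
    by_contra! h
    rcases h.lt_or_eq with h | rfl
    · exact (hgt w h).not_gt hw
    · exact hy.not_gt hw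
  have h0y : (0 : Fin n) < y := (Fin.zero_le w).trans_lt hwy
  -- `g` separates the coefficients `D y l - D k l` with `l < y` from all the others.
  set g := D 0 y - D y k with hg
  have hg0 : 0 < g := sub_pos.2 (hD.block _ _ _ _ h0y hyk hyk)
  have hterm : ∀ l, g * x l ≤ (D y l - D k l) * x l := fun l => by
    rcases lt_trichotomy l y with h | rfl | h
    · refine mul_le_mul_of_nonneg_right ?_ (hlt l h)
      have h1 : D 0 y ≤ D l y := by
        rcases (Fin.zero_le l).eq_or_lt with h0 | h0
        · rw [h0]
        · exact (hD.within _ _ _ h0 h).le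
      have h2 := hD.within _ _ _ h hyk
      rw [hD.symm y l, hD.symm k l]
      linarith
    · rw [hD.diag]
      have := hpos k l
      nlinarith
    · rcases lt_trichotomy l k with h' | rfl | h'
      · refine mul_le_mul_of_nonpos_right ?_ (hgt l h)
        have h1 := hD.block _ _ _ _ h0y h h
        have h2 := hD.within _ _ _ h h'
        rw [hD.symm k l]
        linarith
      · simp [hk]
      · refine mul_le_mul_of_nonpos_right ?_ (hgt l h)
        have := hD.within _ _ _ hyk h'
        linarith
  have hstrict : g * x y < (D y y - D k y) * x y := by
    rw [hD.diag]
    have := hpos k y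
    nlinarith [mul_neg_of_pos_of_neg hg0 hy]
  have h1 : ∑ l, g * x l < ∑ l, (D y l - D k l) * x l :=
    Finset.sum_lt_sum (fun l _ => hterm l) ⟨y, Finset.mem_univ y, hstrict⟩
  rw [← Finset.mul_sum, hsum, mul_zero] at h1
  simp only [sub_mul, Finset.sum_sub_distrib] at h1
  exact sub_pos.1 h1

/-- Let the quadratic form of a nested matrix be nonpositive on the sum-zero vectors with at most
one sign change. Then a nonzero such vector at which the form vanishes has no superfluous zero
entries. -/
theorem IsNested.strictlySwitchesSign {n : ℕ} [NeZero n] {D : Matrix (Fin n) (Fin n) ℝ}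
    (hD : IsNested D)
    (hform : ∀ y : Fin n → ℝ, SwitchesSign y → ∑ i, y i = 0 → y ⬝ᵥ D *ᵥ y ≤ 0)
    {x : Fin n → ℝ} (hx : x ≠ 0) (hsum : ∑ i, x i = 0) (hsw : SwitchesSign x)
    (hzero : x ⬝ᵥ D *ᵥ x = 0) : StrictlySwitchesSign x := by
  have hadd : ∀ (t : ℝ) (a b : Fin n), ∑ i, (x + t • edgeVec a b) i = 0 := fun t a b => by
    simp [Finset.sum_add_distrib, hsum, ← Finset.mul_sum, sum_edgeVec]
  have hval : ∀ (t : ℝ) (a b i : Fin n), (x + t • edgeVec a b) i =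
      x i + t * ((if i = a then 1 else 0) - if i = b then 1 else 0) := fun t a b i => by
    simp [edgeVec, Pi.single_apply]
  have hpos : ∀ i j, 0 ≤ D i j := by
    have hlt : ∀ i j, i < j → 0 ≤ D i j := fun i j hij => by
      have h2 := hform _ (switchesSign_edgeVec hij) (sum_edgeVec i j)
      rw [edgeVec_dotProduct] at h2
      simp only [edgeVec, mulVec_sub, mulVec_single_one, Pi.sub_apply, col_apply, hD.diag,
        hD.symm j i] at h2
      linarith
    intro i j
    rcases lt_trichotomy i j with h | rfl | h
    · exact hlt i j h
    · exact (hD.diag i).ge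
    · rw [hD.symm]; exact hlt j i h
  -- The two moves below keep the vector in the region where the form is nonpositive, while the
  -- form grows along them.
  have move_zero : ∀ k z : Fin n, k < z → x k = 0 → 0 ≤ x z → (∀ l, l < z → 0 ≤ x l) →
      (∀ l, z < l → x l ≤ 0) → False := by
    intro k z hkz hk hz hlt hgt
    refine (hD.mulVec_lt_of_eq_zero hpos hx hsum hkz hk hz hlt hgt).not_ge ?_
    refine mulVec_apply_le_of_forall_quadForm_nonpos hD.symm hzero fun t ht => ?_
    refine hform _ (fun i j hij => ?_) (hadd _ _ _)
    rw [hval, hval]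
    rcases lt_or_ge i z with h | h
    · left
      have := hlt i h
      rw [if_neg h.ne]
      split_ifs <;> nlinarith
    · right
      have hj := h.trans_lt hij
      rw [if_neg hj.ne', if_neg (hkz.trans hj).ne']
      simpa using hgt j hj
  have move_neg : ∀ y k : Fin n, y < k → x k = 0 → x y < 0 → (∀ l, l < y → 0 ≤ x l) →
      (∀ l, y < l → x l ≤ 0) → False := by
    intro y k hyk hk hy hlt hgt
    refine (hD.mulVec_lt_of_neg hpos hx hsum hyk hk hy hlt hgt).not_ge ?_
    refine mulVec_apply_le_of_forall_quadForm_nonpos hD.symm hzero fun t ht => ?_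
    refine hform _ (fun i j hij => ?_) (hadd _ _ _)
    rw [hval, hval]
    rcases lt_or_ge i y with h | h
    · left
      rw [if_neg h.ne, if_neg (h.trans hyk).ne]
      simpa using hlt i h
    · right
      have hj := h.trans_lt hij
      have := hgt j hj
      rw [if_neg hj.ne']
      split_ifs <;> nlinarith
  obtain ⟨⟨p, hp⟩, ⟨q, hq⟩⟩ := exists_pos_and_neg hx hsum
  obtain ⟨m, hm, hmax⟩ : ∃ m, 0 < x m ∧ ∀ l, m < l → x l ≤ 0 := by
    have hne : (Finset.univ.filter fun l => 0 < x l).Nonempty := ⟨p, by simpa using hp⟩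
    refine ⟨Finset.max' _ hne, by simpa using Finset.max'_mem _ hne, fun l hl => ?_⟩
    by_contra! h
    exact hl.not_ge (Finset.le_max' _ l (by simpa using h))
  obtain ⟨y, hy, hmin⟩ : ∃ y, x y < 0 ∧ ∀ l, l < y → 0 ≤ x l := by
    have hne : (Finset.univ.filter fun l => x l < 0).Nonempty := ⟨q, by simpa using hq⟩
    refine ⟨Finset.min' _ hne, by simpa using Finset.min'_mem _ hne, fun l hl => ?_⟩
    by_contra! h
    exact hl.not_ge (Finset.min'_le _ l (by simpa using h))
  have hmy : m < y := by
    rcases lt_trichotomy m y with h | rfl | h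
    · exact h
    · exact absurd hy hm.not_gt
    · exact ((hsw y m h).elim (fun h' => hy.not_ge h') fun h' => hm.not_ge h').elim
  intro i j hij
  by_contra! hcon
  obtain ⟨hi, hj⟩ := hcon
  rcases lt_trichotomy i m with him | rfl | him
  · exact move_zero i m him (le_antisymm hi (hmin i (him.trans hmy))) hm.le
      (fun l hl => hmin l (hl.trans hmy)) hmax
  · exact hi.not_gt hm
  have hj0 : x j = 0 := le_antisymm (hmax j (him.trans hij)) hj
  rcases lt_trichotomy j y with hjy | rfl | hjy
  · exact move_zero i j hij (le_antisymm hi (hmin i (hij.trans hjy))) hj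
      (fun l hl => hmin l (hl.trans hjy)) fun l hl => hmax l (him.trans (hij.trans hl))
  · exact hj.not_gt hy
  · exact move_neg y j hjy hj0 hy hmin fun l hl => hmax l (hmy.trans hl)

/-! ### The critical vector of a nested matrix -/

theorem IsNested.add_smul {n : ℕ} {D : Matrix (Fin n) (Fin n) ℝ} (hD : IsNested D) (c : ℝ) :
    IsNested (D + c • (Matrix.of (fun _ _ => 1) - 1)) where
  symm i j := by simp [hD.symm i j, Matrix.one_apply, eq_comm]
  diag i := by simp [hD.diag]
  block i j k l hij hkl hjl := by
    simpa [Matrix.one_apply, hij.ne, hkl.ne] using hD.block i j k l hij hkl hjl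
  within i k j hik hkj := by
    simpa [Matrix.one_apply, hkj.ne, (hik.trans hkj).ne] using hD.within i k j hik hkj

theorem quadForm_add_smul_of_sum_eq_zero {n : ℕ} (D : Matrix (Fin n) (Fin n) ℝ) (c : ℝ)
    {x : Fin n → ℝ} (hsum : ∑ i, x i = 0) :
    x ⬝ᵥ (D + c • (Matrix.of (fun _ _ => 1) - 1)) *ᵥ x = x ⬝ᵥ D *ᵥ x - c * (x ⬝ᵥ x) := by
  have : (Matrix.of (fun _ _ => (1 : ℝ)) : Matrix (Fin n) (Fin n) ℝ) *ᵥ x = 0 := by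
    ext i
    simp [mulVec, dotProduct, hsum]
  simp [add_mulVec, smul_mulVec, sub_mulVec, this, dotProduct_add]
  ring

/-- A constant can be added to the off-diagonal entries so that the form becomes nonpositive on
the sum-zero vectors with at most one sign change and vanishes at a nonzero one of them. -/
theorem exists_shift_quadForm_nonpos {n : ℕ} (E : Matrix (Fin n) (Fin n) ℝ) (hn : 2 ≤ n) :
    ∃ (c : ℝ) (x : Fin n → ℝ), x ≠ 0 ∧ ∑ i, x i = 0 ∧ SwitchesSign x ∧
      x ⬝ᵥ (E + c • (Matrix.of (fun _ _ => 1) - 1)) *ᵥ x = 0 ∧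
      ∀ y : Fin n → ℝ, SwitchesSign y → ∑ i, y i = 0 →
        y ⬝ᵥ (E + c • (Matrix.of (fun _ _ => 1) - 1)) *ᵥ y ≤ 0 := by
  let K : Set (Fin n → ℝ) := {x | SwitchesSign x} ∩ {x | ∑ i, x i = 0} ∩ {x | x ⬝ᵥ x = 1}
  have hcont : Continuous fun x : Fin n → ℝ => x ⬝ᵥ x := by unfold dotProduct; fun_prop
  have hK : IsCompact K := by
    refine Metric.isCompact_of_isClosed_isBounded ?_ ?_
    · refine ((isClosed_setOf_switchesSign n).inter ?_).inter ?_
      · exact isClosed_eq (by fun_prop) continuous_const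
      · exact isClosed_eq hcont continuous_const
    · refine (Metric.isBounded_closedBall (x := (0 : Fin n → ℝ)) (r := 1)).subset fun x hx => ?_
      have h1 : ∑ i, x i * x i = 1 := hx.2
      rw [mem_closedBall_zero_iff, pi_norm_le_iff_of_nonneg zero_le_one]
      intro i
      have h2 : x i * x i ≤ 1 := h1 ▸ Finset.single_le_sum (f := fun i => x i * x i)
        (fun i _ => mul_self_nonneg (x i)) (Finset.mem_univ i)
      rw [Real.norm_eq_abs]
      exact abs_le_one_iff_mul_self_le_one.2 h2
  have hscale : ∀ y : Fin n → ℝ, SwitchesSign y → ∑ i, y i = 0 → y ≠ 0 →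
      (Real.sqrt (y ⬝ᵥ y))⁻¹ • y ∈ K := fun y hy hs h0 => by
    have hpos : 0 < y ⬝ᵥ y :=
      lt_of_le_of_ne (Finset.sum_nonneg fun i _ => mul_self_nonneg (y i))
        (Ne.symm (by simpa [dotProduct_self_eq_zero] using h0))
    have hr : 0 < (Real.sqrt (y ⬝ᵥ y))⁻¹ := by positivity
    refine ⟨⟨fun i j hij => ?_, ?_⟩, ?_⟩
    · refine (hy i j hij).imp (fun h => ?_) fun h => ?_
      · exact mul_nonneg hr.le h
      · exact mul_nonpos_of_nonneg_of_nonpos hr.le h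
    · simp [← Finset.mul_sum, hs]
    · simp only [Set.mem_ofPred_eq, smul_dotProduct, dotProduct_smul, smul_eq_mul]
      rw [← mul_assoc, ← mul_inv, Real.mul_self_sqrt hpos.le, inv_mul_cancel₀ hpos.ne']
  have hne : K.Nonempty := by
    have h01 : (⟨0, by omega⟩ : Fin n) < ⟨1, by omega⟩ := by simp
    refine ⟨_, hscale _ (switchesSign_edgeVec h01) (sum_edgeVec _ _) fun h => ?_⟩
    have := congrFun h ⟨0, by omega⟩
    simp [edgeVec] at this
  have hq : ContinuousOn (fun x : Fin n → ℝ => x ⬝ᵥ E *ᵥ x) K := by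
    refine Continuous.continuousOn ?_
    unfold mulVec dotProduct
    fun_prop
  obtain ⟨x, hxK, hmax⟩ := hK.exists_isMaxOn hne hq
  refine ⟨x ⬝ᵥ E *ᵥ x, x, ?_, hxK.1.2, hxK.1.1, ?_, fun y hy hs => ?_⟩
  · rintro rfl
    have : (0 : Fin n → ℝ) ⬝ᵥ 0 = 1 := hxK.2
    simp at this
  · rw [quadForm_add_smul_of_sum_eq_zero _ _ hxK.1.2, show x ⬝ᵥ x = 1 from hxK.2]
    ring
  · rw [quadForm_add_smul_of_sum_eq_zero _ _ hs]
    rcases eq_or_ne y 0 with rfl | h0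
    · simp
    have hpos : 0 < y ⬝ᵥ y :=
      lt_of_le_of_ne (Finset.sum_nonneg fun i _ => mul_self_nonneg (y i))
        (Ne.symm (by simpa [dotProduct_self_eq_zero] using h0))
    have h1 : _ ≤ x ⬝ᵥ E *ᵥ x := hmax (hscale y hy hs h0)
    simp only [mulVec_smul, smul_dotProduct, dotProduct_smul, smul_eq_mul] at h1
    rw [← mul_assoc, ← mul_inv, Real.mul_self_sqrt hpos.le, inv_mul_le_iff₀ hpos] at h1
    linarith

/-- If the form is nonpositive on the sum-zero vectors with at most one sign change and vanishes
at such a vector `x ≠ 0`, then it is nonpositive on all sum-zero vectors: `x` lies in the interior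
of the region, and a local maximum of a Rayleigh quotient is global. -/
theorem IsNested.quadForm_nonpos {n : ℕ} [NeZero n] {D : Matrix (Fin n) (Fin n) ℝ}
    (hD : IsNested D)
    (hform : ∀ y : Fin n → ℝ, SwitchesSign y → ∑ i, y i = 0 → y ⬝ᵥ D *ᵥ y ≤ 0)
    {x : Fin n → ℝ} (hx : x ≠ 0) (hsum : ∑ i, x i = 0) (hsw : SwitchesSign x)
    (hzero : x ⬝ᵥ D *ᵥ x = 0) {y : Fin n → ℝ} (hy : ∑ i, y i = 0) : y ⬝ᵥ D *ᵥ y ≤ 0 := by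
  have hS := hD.strictlySwitchesSign hform hx hsum hsw hzero
  have hopen : ∀ z : Fin n → ℝ, ∀ᶠ t : ℝ in nhds 0, StrictlySwitchesSign (x + t • z) := by
    intro z
    have hc : Filter.Tendsto (fun t : ℝ => x + t • z) (nhds 0) (nhds x) := by
      have : Continuous fun t : ℝ => x + t • z := by fun_prop
      simpa using this.tendsto 0
    exact hc ((isOpen_setOf_strictlySwitchesSign n).mem_nhds hS)
  obtain ⟨t, ⟨h1, h2⟩, ht⟩ := ((((hopen y).and (hopen (-y))).filter_mono
    nhdsWithin_le_nhds).and (self_mem_nhdsWithin (s := Set.Ioi (0 : ℝ)))).exists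
  have hs : ∀ z : Fin n → ℝ, ∑ i, z i = 0 → ∑ i, (x + t • z) i = 0 := fun z hz => by
    simp [Finset.sum_add_distrib, ← Finset.mul_sum, hsum, hz]
  have e1 := hform _ h1.switchesSign (hs y hy)
  have e2 := hform _ h2.switchesSign (hs (-y) (by simp [hy]))
  rw [quadForm_add_smul hD.symm, hzero] at e1 e2
  simp only [mulVec_neg, neg_dotProduct, dotProduct_neg, neg_neg] at e2
  have ht2 : 0 < t ^ 2 := pow_pos ht 2
  by_contra! h
  nlinarith [mul_pos ht2 h]

/-- If the form of a nested matrix is nonpositive on the sum-zero vectors, then it does not vanish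
at a nonzero sum-zero vector whose first entry is zero. In particular the nonpositive form is
degenerate in at most one direction. -/
theorem IsNested.apply_zero_ne_zero {n : ℕ} [NeZero n] {D : Matrix (Fin n) (Fin n) ℝ}
    (hD : IsNested D) (hform : ∀ y : Fin n → ℝ, ∑ i, y i = 0 → y ⬝ᵥ D *ᵥ y ≤ 0)
    {y : Fin n → ℝ} (hy : y ≠ 0) (hysum : ∑ i, y i = 0) (hyzero : y ⬝ᵥ D *ᵥ y = 0) :
    y 0 ≠ 0 := by
  intro hy0
  have hn : 2 ≤ n := by
    by_contra! h
    obtain rfl : n = 1 := by have := NeZero.pos n; omega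
    exact hy (funext fun i => by rw [Subsingleton.elim i 0, hy0]; rfl)
  obtain ⟨c, x, hx, hsum, hsw, hzero, hform'⟩ := exists_shift_quadForm_nonpos D hn
  have hglob := fun z hz => (hD.add_smul c).quadForm_nonpos hform' hx hsum hsw hzero (y := z) hz
  have hsq : ∀ z : Fin n → ℝ, z ≠ 0 → 0 < z ⬝ᵥ z := fun z h0 =>
    lt_of_le_of_ne (Finset.sum_nonneg fun i _ => mul_self_nonneg (z i))
      (Ne.symm (by simpa [dotProduct_self_eq_zero] using h0))
  -- The form of `D` itself is nonpositive and degenerate, hence no shift is needed.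
  have hc : c = 0 := by
    have h1 := hglob y hysum
    rw [quadForm_add_smul_of_sum_eq_zero _ _ hysum, hyzero] at h1
    rw [quadForm_add_smul_of_sum_eq_zero _ _ hsum] at hzero
    have h2 := hform x hsum
    have h3 := hsq y hy
    have h4 := hsq x hx
    refine le_antisymm ?_ ?_ <;> by_contra! h <;> nlinarith
  subst hc
  rw [zero_smul, add_zero] at hzero
  clear hform' hglob
  have hcross : y ⬝ᵥ D *ᵥ x = 0 := by
    have key : ∀ t : ℝ, 2 * t * (y ⬝ᵥ D *ᵥ x) ≤ 0 := fun t => by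
      have := hform (x + t • y) (by simp [Finset.sum_add_distrib, ← Finset.mul_sum, hsum, hysum])
      rw [quadForm_add_smul hD.symm, hzero, hyzero] at this
      linarith
    linarith [key 1, key (-1)]
  have hstrict : ∀ z : Fin n → ℝ, z ≠ 0 → ∑ i, z i = 0 → z ⬝ᵥ D *ᵥ z = 0 → SwitchesSign z →
      StrictlySwitchesSign z := fun z h0 hs hz hw =>
    hD.strictlySwitchesSign (fun w _ hw => hform w hw) h0 hs hw hz
  have hx0 := (hstrict x hx hsum hzero hsw).pos_zero hx hsum
  -- On the line `x + t • y` the weak and the strict sign condition agree, so they hold throughout.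
  have hclopen : IsClopen {t : ℝ | SwitchesSign (x + t • y)} := by
    have hcont : Continuous fun t : ℝ => x + t • y := by fun_prop
    refine ⟨(isClosed_setOf_switchesSign n).preimage hcont, ?_⟩
    convert (isOpen_setOf_strictlySwitchesSign n).preimage hcont using 1
    ext t
    refine ⟨fun h => hstrict _ (fun h0 => ?_) ?_ ?_ h, fun h => StrictlySwitchesSign.switchesSign h⟩
    · have := congrFun h0 0
      simp [hy0, hx0.ne'] at this
    · simp [Finset.sum_add_distrib, ← Finset.mul_sum, hsum, hysum]
    · rw [quadForm_add_smul hD.symm, hzero, hyzero, hcross]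
      ring
  have hall : ∀ t : ℝ, SwitchesSign (x + t • y) := fun t => by
    have := hclopen.eq_univ ⟨0, by simpa using hsw⟩
    exact this.ge (Set.mem_univ t)
  have hysw : SwitchesSign y := fun i j hij => by
    by_contra! h
    obtain ⟨hi, hj⟩ := h
    have h1 : 0 ≤ |x i| / -y i := div_nonneg (abs_nonneg _) (neg_nonneg.2 hi.le)
    have h2 : 0 ≤ |x j| / y j := by positivity
    have h3 : |x i| / -y i * y i = -|x i| := by
      field_simp [hi.ne]
    have h4 : |x j| / y j * y j = |x j| := div_mul_cancel₀ _ hj.ne'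
    have h5 := hall (|x i| / -y i + |x j| / y j + 1) i j hij
    simp only [Pi.add_apply, Pi.smul_apply, smul_eq_mul, add_mul, h3, h4] at h5
    rcases h5 with h5 | h5
    · nlinarith [le_abs_self (x i)]
    · nlinarith [neg_abs_le (x j)]
  exact ((hstrict y hy hysum hyzero hysw).pos_zero hy hysum).ne' hy0

/-! ### Lower bounds -/

/-- The matrix of squared distances of a point collection. -/
noncomputable def sqDist {n d : ℕ} (p : Fin n → EuclideanSpace ℝ (Fin d)) :
    Matrix (Fin n) (Fin n) ℝ :=
  Matrix.of fun i j => dist (p i) (p j) ^ 2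

theorem quadForm_sqDist {n d : ℕ} (p : Fin n → EuclideanSpace ℝ (Fin d)) {x : Fin n → ℝ}
    (hx : ∑ i, x i = 0) : x ⬝ᵥ sqDist p *ᵥ x = -2 * ‖∑ i, x i • p i‖ ^ 2 := by
  have h1 : ‖∑ i, x i • p i‖ ^ 2 = ∑ i, ∑ j, x i * x j * inner ℝ (p i) (p j) := by
    rw [← real_inner_self_eq_norm_sq, sum_inner]
    simp only [inner_sum, inner_smul_left, inner_smul_right, conj_trivial]
    refine Finset.sum_congr rfl fun i _ => Finset.sum_congr rfl fun j _ => ?_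
    ring
  have h2 : x ⬝ᵥ sqDist p *ᵥ x = ∑ i, ∑ j, (x i * ‖p i‖ ^ 2 * x j + x i * (x j * ‖p j‖ ^ 2)
      - 2 * (x i * x j * inner ℝ (p i) (p j))) := by
    simp only [dotProduct, mulVec, Finset.mul_sum, sqDist, of_apply, dist_eq_norm,
      norm_sub_sq_real]
    refine Finset.sum_congr rfl fun i _ => Finset.sum_congr rfl fun j _ => ?_
    ring
  rw [h2, h1]
  simp only [Finset.sum_sub_distrib, Finset.sum_add_distrib, ← Finset.mul_sum, ← Finset.sum_mul,
    hx]
  ring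

/-- The pairs ordered so that raising the larger index shrinks the distance, and, for a fixed
larger index, raising the smaller one increases the distance. -/
def nestedOrder (n : ℕ) (e f : DistPair n) : Prop :=
  f.1.2 < e.1.2 ∨ e.1.2 = f.1.2 ∧ e.1.1 ≤ f.1.1

theorem isLinearOrder_nestedOrder (n : ℕ) : IsLinearOrder (DistPair n) (nestedOrder n) where
  refl e := Or.inr ⟨rfl, le_rfl⟩
  trans e f g := by
    unfold nestedOrder
    grind
  antisymm e f := by
    unfold nestedOrder
    intro h1 h2
    apply Subtype.ext
    apply Prod.ext <;> grind
  total e f := by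
    unfold nestedOrder
    grind

theorem Induces.dist_lt {n d : ℕ} {p : Fin n → EuclideanSpace ℝ (Fin d)}
    {r : DistPair n → DistPair n → Prop} (h : Induces p r) {e f : DistPair n} (hfe : ¬ r f e) :
    pairDist p e < pairDist p f :=
  not_le.1 (mt (h f e).2 hfe)

theorem isNested_sqDist {n d : ℕ} {p : Fin n → EuclideanSpace ℝ (Fin d)}
    (h : Induces p (nestedOrder n)) : IsNested (sqDist p) where
  symm i j := by simp [sqDist, dist_comm]
  diag i := by simp [sqDist]
  block i j k l hij hkl hjl := by
    have := h.dist_lt (e := ⟨(k, l), hkl⟩) (f := ⟨(i, j), hij⟩) (by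
      simp only [nestedOrder]; grind)
    exact pow_lt_pow_left₀ this dist_nonneg two_ne_zero
  within i k j hik hkj := by
    have := h.dist_lt (e := ⟨(i, j), hik.trans hkj⟩) (f := ⟨(k, j), hkj⟩) (by
      simp only [nestedOrder]; grind)
    exact pow_lt_pow_left₀ this dist_nonneg two_ne_zero

/-- Points in a space of small dimension satisfy an affine dependency with a prescribed zero. -/
theorem exists_dependency_apply_eq_zero {n d : ℕ} (p : Fin n → EuclideanSpace ℝ (Fin d))
    (a : Fin n) (h : d + 2 < n) :
    ∃ x : Fin n → ℝ, x ≠ 0 ∧ ∑ i, x i = 0 ∧ ∑ i, x i • p i = 0 ∧ x a = 0 := by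
  let L : (Fin n → ℝ) →ₗ[ℝ] EuclideanSpace ℝ (Fin d) × ℝ × ℝ :=
    (Fintype.linearCombination ℝ p).prod
      ((Fintype.linearCombination ℝ (fun _ : Fin n => (1 : ℝ))).prod (LinearMap.proj a))
  obtain ⟨x, hx, h0⟩ := (Submodule.ne_bot_iff _).1
    (L.ker_ne_bot_of_finrank_lt (by simpa [Module.finrank_prod] using h))
  have h1 : L x = 0 := hx
  simp only [L, LinearMap.prod_apply, Function.prod, Prod.mk_eq_zero,
    Fintype.linearCombination_apply, smul_eq_mul, mul_one, LinearMap.proj_apply] at h1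
  exact ⟨x, h0, h1.2.1, h1.1, h1.2.2⟩

theorem exists_dependency {n d : ℕ} (p : Fin n → EuclideanSpace ℝ (Fin d)) (h : d + 1 < n) :
    ∃ x : Fin n → ℝ, x ≠ 0 ∧ ∑ i, x i = 0 ∧ ∑ i, x i • p i = 0 := by
  let L : (Fin n → ℝ) →ₗ[ℝ] EuclideanSpace ℝ (Fin d) × ℝ :=
    (Fintype.linearCombination ℝ p).prod (Fintype.linearCombination ℝ (fun _ : Fin n => (1 : ℝ)))
  obtain ⟨x, hx, h0⟩ := (Submodule.ne_bot_iff _).1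
    (L.ker_ne_bot_of_finrank_lt (by simpa [Module.finrank_prod] using h))
  have h1 : L x = 0 := hx
  simp only [L, LinearMap.prod_apply, Function.prod, Prod.mk_eq_zero,
    Fintype.linearCombination_apply, smul_eq_mul, mul_one] at h1
  exact ⟨x, h0, h1.2, h1.1⟩

theorem not_induces_nestedOrder {n d : ℕ} (hd : d + 2 < n)
    (p : Fin n → EuclideanSpace ℝ (Fin d)) : ¬ Induces p (nestedOrder n) := by
  intro h
  have : NeZero n := ⟨by omega⟩
  obtain ⟨x, hx, hsum, hdep, h0⟩ := exists_dependency_apply_eq_zero p 0 hd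
  refine (isNested_sqDist h).apply_zero_ne_zero (fun y hy => ?_) hx hsum ?_ h0
  · rw [quadForm_sqDist p hy]
    have := sq_nonneg ‖∑ i, y i • p i‖
    linarith
  · rw [quadForm_sqDist p hsum, hdep]
    simp

/-- More than `d + 1` distinct points of `ℝ^d` are not pairwise equidistant. -/
theorem not_induces_true {n d : ℕ} (hd : d + 1 < n) {p : Fin n → EuclideanSpace ℝ (Fin d)}
    (hp : Function.Injective p) : ¬ Induces p (fun _ _ => True) := by
  intro h
  have hle : ∀ i j k l : Fin n, i ≠ j → k ≠ l → dist (p i) (p j) ≤ dist (p k) (p l) := by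
    have hlt : ∀ i j k l : Fin n, i < j → k < l → dist (p i) (p j) ≤ dist (p k) (p l) :=
      fun i j k l hij hkl => (h ⟨(i, j), hij⟩ ⟨(k, l), hkl⟩).1 trivial
    intro i j k l hij hkl
    rcases lt_or_gt_of_ne hij with h1 | h1 <;> rcases lt_or_gt_of_ne hkl with h2 | h2
    · exact hlt i j k l h1 h2
    · rw [dist_comm (p k)]; exact hlt i j l k h1 h2
    · rw [dist_comm (p i)]; exact hlt j i k l h1 h2
    · rw [dist_comm (p i), dist_comm (p k)]; exact hlt j i l k h1 h2
  obtain ⟨x, hx, hsum, hdep⟩ := exists_dependency p hd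
  have h01 : (⟨0, by omega⟩ : Fin n) ≠ ⟨1, by omega⟩ := by simp
  set s := dist (p ⟨0, by omega⟩) (p ⟨1, by omega⟩) ^ 2 with hs
  have hs0 : 0 < s := pow_pos (dist_pos.2 (hp.ne h01)) 2
  have hD : sqDist p = 0 + s • (Matrix.of (fun _ _ => 1) - 1) := by
    ext i j
    by_cases hij : i = j
    · simp [sqDist, hij]
    · simp [sqDist, hij, hs, le_antisymm (hle i j _ _ hij h01)
        (hle _ _ i j h01 hij)]
  have h1 := quadForm_sqDist p hsum
  rw [hD, quadForm_add_smul_of_sum_eq_zero _ _ hsum, hdep] at h1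
  simp [hs0.ne', dotProduct_self_eq_zero, hx] at h1

/-! ### Prescribing distances near a configuration without self-stress -/

/-- The stress matrix of a weight on the pairs. Its rows are sum-zero, and its off-diagonal
entries are the negatives of the weights. -/
def stressMatrix {n : ℕ} (w : DistPair n → ℝ) : Matrix (Fin n) (Fin n) ℝ :=
  Matrix.of fun k l => ∑ e : DistPair n, w e * edgeVec e.1.1 e.1.2 k * edgeVec e.1.1 e.1.2 l

theorem stressMatrix_comm {n : ℕ} (w : DistPair n → ℝ) (k l : Fin n) :
    stressMatrix w k l = stressMatrix w l k := by
  simp only [stressMatrix, of_apply, mul_right_comm]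

theorem sum_stressMatrix {n : ℕ} (w : DistPair n → ℝ) (k : Fin n) :
    ∑ l, stressMatrix w k l = 0 := by
  simp only [stressMatrix, of_apply]
  rw [Finset.sum_comm]
  simp only [← Finset.mul_sum, sum_edgeVec, mul_zero, Finset.sum_const_zero]

theorem stressMatrix_apply {n : ℕ} (w : DistPair n → ℝ) (e : DistPair n) :
    stressMatrix w e.1.1 e.1.2 = -w e := by
  simp only [stressMatrix, of_apply]
  rw [Finset.sum_eq_single e]
  · simp [edgeVec, e.2.ne, e.2.ne']
  · rintro ⟨⟨i, j⟩, hij⟩ - hne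
    obtain ⟨⟨k, l⟩, hkl⟩ := e
    simp only [ne_eq, Subtype.mk.injEq, Prod.mk.injEq, not_and] at hne
    simp only [edgeVec, Pi.sub_apply, Pi.single_apply]
    simp only at hij hkl
    grind
  · simp

theorem sum_edgeVec_smul {n : ℕ} {V : Type*} [AddCommGroup V] [Module ℝ V] (p : Fin n → V)
    (a b : Fin n) : ∑ i, edgeVec a b i • p i = p a - p b := by
  simp [edgeVec, sub_smul, Pi.single_apply, ite_smul]

/-- If the weighted sum of the rigidity rows vanishes, then every row of the stress matrix is an
affine dependency of the points. -/
theorem sum_stressMatrix_smul {n d : ℕ} {p : Fin n → EuclideanSpace ℝ (Fin d)}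
    {w : DistPair n → ℝ} (hw : ∀ v : Fin n → EuclideanSpace ℝ (Fin d),
      ∑ e : DistPair n, w e * inner ℝ (p e.1.1 - p e.1.2) (v e.1.1 - v e.1.2) = 0) (k : Fin n) :
    ∑ l, stressMatrix w k l • p l = 0 := by
  have h1 : ∑ l, stressMatrix w k l • p l =
      ∑ e : DistPair n, (w e * edgeVec e.1.1 e.1.2 k) • (p e.1.1 - p e.1.2) := by
    simp only [stressMatrix, of_apply, Finset.sum_smul]
    rw [Finset.sum_comm]
    refine Finset.sum_congr rfl fun e _ => ?_
    simp only [mul_smul, ← Finset.smul_sum, sum_edgeVec_smul]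
  rw [h1]
  refine ext_inner_right ℝ fun u => ?_
  rw [inner_zero_left, ← hw (Pi.single k u), sum_inner]
  refine Finset.sum_congr rfl fun e _ => ?_
  have h2 : (Pi.single k u : Fin n → EuclideanSpace ℝ (Fin d)) e.1.1 -
      (Pi.single k u : Fin n → EuclideanSpace ℝ (Fin d)) e.1.2 =
      edgeVec e.1.1 e.1.2 k • u := by
    simp only [edgeVec, Pi.sub_apply, Pi.single_apply, sub_smul, ite_smul, one_smul, zero_smul,
      eq_comm (a := k)]
  rw [h2, inner_smul_left, inner_smul_right, conj_trivial]
  ring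

/-- Near a configuration, all small perturbations of the squared distances are realized, up to a
multiple of `g`, when no nonzero self-stress is orthogonal to `g`. Taking for `g` the indicator of
a pair leaves the distance of that pair unconstrained. -/
theorem exists_perturbation {n d : ℕ} (p₀ : Fin n → EuclideanSpace ℝ (Fin d))
    (g : DistPair n → ℝ) (s₀ c : ℝ) (hc : ∀ e, pairDist p₀ e ^ 2 + s₀ * g e = c)
    (hstress : ∀ w : DistPair n → ℝ, ∑ e, w e * g e = 0 →
      (∀ v : Fin n → EuclideanSpace ℝ (Fin d),
        ∑ e : DistPair n, w e * inner ℝ (p₀ e.1.1 - p₀ e.1.2) (v e.1.1 - v e.1.2) = 0) → w = 0)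
    {U : Set (Fin n → EuclideanSpace ℝ (Fin d))} (hU : U ∈ nhds p₀) (h : DistPair n → ℝ) :
    ∃ p ∈ U, ∃ ε : ℝ, 0 < ε ∧ ∃ s : ℝ, ∀ e, pairDist p e ^ 2 + s * g e = c + ε * h e := by
  let X := (Fin n → EuclideanSpace ℝ (Fin d)) × ℝ
  let F : X → DistPair n → ℝ := fun x e => ‖x.1 e.1.1 - x.1 e.1.2‖ ^ 2 + x.2 * g e
  let ev : Fin n → X →L[ℝ] EuclideanSpace ℝ (Fin d) := fun i =>
    (ContinuousLinearMap.proj i).comp (ContinuousLinearMap.fst ℝ _ ℝ)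
  let F' : X →L[ℝ] DistPair n → ℝ := ContinuousLinearMap.pi fun e =>
    (2 • innerSL ℝ (p₀ e.1.1 - p₀ e.1.2)).comp (ev e.1.1 - ev e.1.2) +
      (ContinuousLinearMap.snd ℝ _ ℝ).smulRight (g e)
  have hF : HasStrictFDerivAt F F' (p₀, s₀) := by
    rw [hasStrictFDerivAt_pi']
    intro e
    have h1 : HasStrictFDerivAt (fun x : X => x.1 e.1.1 - x.1 e.1.2) (ev e.1.1 - ev e.1.2)
      (p₀, s₀) := (ev e.1.1 - ev e.1.2).hasStrictFDerivAt
    have h2 : HasStrictFDerivAt (fun x : X => x.2 * g e)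
        ((ContinuousLinearMap.snd ℝ _ ℝ).smulRight (g e)) (p₀, s₀) :=
      ((ContinuousLinearMap.snd ℝ _ ℝ).smulRight (g e) : X →L[ℝ] ℝ).hasStrictFDerivAt
    exact ((hasStrictFDerivAt_norm_sq _).comp (p₀, s₀) h1).add h2
  have hsurj : (F' : X →ₗ[ℝ] DistPair n → ℝ).range = ⊤ := by
    by_contra hne
    obtain ⟨φ, hφ, hker⟩ := Submodule.exists_le_ker_of_lt_top _ (lt_top_iff_ne_top.2 hne)
    have hrep : ∀ y, φ y = ∑ e, φ (Pi.single e 1) * y e := fun y => by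
      conv_lhs => rw [pi_eq_sum_univ' y]
      simp [mul_comm]
    have h0 : ∀ x : X, ∑ e, φ (Pi.single e 1) * F' x e = 0 := fun x => by
      rw [← hrep]
      exact hker ⟨x, rfl⟩
    have hF'_apply : ∀ v t e, F' (v, t) e =
        2 * inner ℝ (p₀ e.1.1 - p₀ e.1.2) (v e.1.1 - v e.1.2) + t * g e := fun v t e => by
      change 2 • inner ℝ (p₀ e.1.1 - p₀ e.1.2) (v e.1.1 - v e.1.2) + t * g e = _
      rw [nsmul_eq_mul, Nat.cast_ofNat]
    have hz := hstress (fun e => φ (Pi.single e 1))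
      (by simpa [hF'_apply] using h0 (0, 1))
      fun v => by
        have := h0 (v, 0)
        simp only [hF'_apply, zero_mul, add_zero, mul_left_comm _ (2 : ℝ),
          ← Finset.mul_sum] at this
        linarith
    exact hφ (LinearMap.ext fun y => by
      rw [hrep]
      simp [fun e => congrFun hz e])
  have hmap := hF.map_nhds_eq_of_surj hsurj
  have hFc : F (p₀, s₀) = fun _ => c := funext fun e => by
    rw [← hc e]
    simp [F, pairDist, dist_eq_norm]
  have hV : F '' (Prod.fst ⁻¹' U) ∈ nhds (fun _ : DistPair n => c) := by
    rw [← hFc, ← hmap]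
    exact Filter.image_mem_map (continuous_fst.continuousAt.preimage_mem_nhds hU)
  have hlim : Filter.Tendsto (fun ε : ℝ => fun e => c + ε * h e) (nhds 0)
      (nhds (fun _ : DistPair n => c)) := by
    have : Continuous fun ε : ℝ => fun e => c + ε * h e := by fun_prop
    simpa using this.tendsto 0
  obtain ⟨ε, ⟨⟨p, s⟩, hp, hps⟩, hε⟩ := (((hlim.eventually hV).filter_mono
    nhdsWithin_le_nhds).and (self_mem_nhdsWithin (s := Set.Ioi (0 : ℝ)))).exists
  refine ⟨p, hp, ε, hε, s, fun e => ?_⟩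
  rw [← congrFun hps e]
  simp [F, pairDist, dist_eq_norm]

/-! ### General position -/

/-- Every affine dependency of the points with a vanishing coefficient is trivial. -/
def HasOnlyFullDependencies {n d : ℕ} (p : Fin n → EuclideanSpace ℝ (Fin d)) : Prop :=
  ∀ x : Fin n → ℝ, ∑ i, x i = 0 → ∑ i, x i • p i = 0 → (∃ k, x k = 0) → x = 0

theorem affineIndependent_of_forall_dependency {n d : ℕ} {p : Fin n → EuclideanSpace ℝ (Fin d)}
    {s : Finset (Fin n)} (h : ∀ x : Fin n → ℝ, ∑ i, x i = 0 → ∑ i, x i • p i = 0 →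
      (∀ i, i ∉ s → x i = 0) → x = 0) : AffineIndependent ℝ (fun i : s => p i) := by
  rw [affineIndependent_iff]
  intro t w hw hwp e he
  let x : Fin n → ℝ := fun i => ∑ a ∈ t, if a.1 = i then w a else 0
  have hx : x = 0 := by
    refine h x ?_ ?_ fun i hi => ?_
    · simp only [x]
      rw [Finset.sum_comm]
      simpa using hw
    · simp only [x, Finset.sum_smul]
      rw [Finset.sum_comm]
      simpa [ite_smul] using hwp
    · exact Finset.sum_eq_zero fun a _ => if_neg fun (ha : a.1 = i) => hi (ha ▸ a.2)
  have h1 : x e = w e := by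
    simp only [x]
    rw [Finset.sum_eq_single e (fun a _ ha => if_neg fun h' => ha (Subtype.ext h'))
      (fun h' => absurd he h')]
    simp
  rw [← h1, hx]
  rfl

theorem HasOnlyFullDependencies.injective {n d : ℕ} {p : Fin n → EuclideanSpace ℝ (Fin d)}
    (hn : 3 ≤ n) (h : HasOnlyFullDependencies p) : Function.Injective p := by
  intro i j hij
  by_contra hne
  obtain ⟨k, hk⟩ := Finset.exists_mem_notMem_of_card_lt_card (s := {i, j})
    (t := (Finset.univ : Finset (Fin n)))
    (Finset.card_le_two.trans_lt (by rw [Finset.card_univ, Fintype.card_fin]; omega))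
  simp only [Finset.mem_insert, Finset.mem_singleton, not_or] at hk
  have := h (edgeVec i j) (sum_edgeVec i j) (by rw [sum_edgeVec_smul, hij, sub_self])
    ⟨k, by simp [edgeVec, hk.2.1, hk.2.2]⟩
  have := congrFun this i
  simp [edgeVec, hne] at this

theorem HasOnlyFullDependencies.inGeneralPosition {n d : ℕ}
    {p : Fin n → EuclideanSpace ℝ (Fin d)} (hn : 3 ≤ n) (hd : d + 2 = n)
    (h : HasOnlyFullDependencies p) : InGeneralPosition p := by
  refine ⟨h.injective hn, fun s hs => affineIndependent_of_forall_dependency fun x h1 h2 h3 => ?_⟩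
  obtain ⟨k, -, hk⟩ := Finset.exists_mem_notMem_of_card_lt_card (s := s)
    (t := (Finset.univ : Finset (Fin n))) (by simp; omega)
  exact h x h1 h2 ⟨k, h3 k hk⟩

theorem isOpen_setOf_inGeneralPosition (n d : ℕ) :
    IsOpen {p : Fin n → EuclideanSpace ℝ (Fin d) | InGeneralPosition p} := by
  have h1 : IsOpen {p : Fin n → EuclideanSpace ℝ (Fin d) | Function.Injective p} := by
    have : {p : Fin n → EuclideanSpace ℝ (Fin d) | Function.Injective p} =
        ⋂ (i : Fin n) (j : Fin n) (_ : i ≠ j), {p | p i ≠ p j} := by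
      ext p
      simp only [Set.mem_iInter]
      exact ⟨fun hp i j hij => hp.ne hij, fun hp i j hij => by
        by_contra hne
        exact hp i j hne hij⟩
    rw [this]
    exact isOpen_iInter_of_finite fun i => isOpen_iInter_of_finite fun j =>
      isOpen_iInter_of_finite fun _ => isOpen_ne_fun (continuous_apply i) (continuous_apply j)
  have h2 : IsOpen {p : Fin n → EuclideanSpace ℝ (Fin d) | ∀ s : Finset (Fin n), s.card ≤ d + 1 →
      AffineIndependent ℝ (fun i : s => p i)} := by
    simp only [Set.ofPred_forall]
    refine isOpen_iInter_of_finite fun s => isOpen_iInter_of_finite fun _ => ?_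
    have hc : Continuous fun (p : Fin n → EuclideanSpace ℝ (Fin d)) (i : s) => p i := by fun_prop
    exact isOpen_setOfPred_affineIndependent.preimage hc
  exact h1.inter h2

/-! ### The regular bipyramid -/

/-- The vertices of a bipyramid over the standard simplex of `ℝ^m`: the standard basis vectors and,
for `s = ±1`, the points `(1 + s √(1 + m)) / m • (1, …, 1)`, all at distance `√2` from the basis
vectors. -/
noncomputable def bipyramid (m : ℕ) : Fin m ⊕ Bool → EuclideanSpace ℝ (Fin m)
  | .inl k => EuclideanSpace.single k 1
  | .inr s => WithLp.toLp 2 fun _ => (1 + (if s then 1 else -1) * √(1 + m)) / m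

theorem dist_sq_bipyramid {m : ℕ} (hm : m ≠ 0) (u v : Fin m ⊕ Bool) (huv : u ≠ v)
    (hne : u.isLeft ∨ v.isLeft) : dist (bipyramid m u) (bipyramid m v) ^ 2 = 2 := by
  have hm' : (m : ℝ) ≠ 0 := Nat.cast_ne_zero.2 hm
  have hsq : √(1 + m) ^ 2 = 1 + (m : ℝ) := Real.sq_sqrt (by positivity)
  have hmix : ∀ (k : Fin m) (s : Bool),
      dist (bipyramid m (.inl k)) (bipyramid m (.inr s)) ^ 2 = 2 := fun k s => by
    rw [EuclideanSpace.dist_sq_eq]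
    set t : ℝ := (1 + (if s then 1 else -1) * √(1 + m)) / m with ht
    have h1 : ∀ i, dist ((bipyramid m (.inl k)).ofLp i) ((bipyramid m (.inr s)).ofLp i) ^ 2 =
        (if i = k then 1 - 2 * t else 0) + t ^ 2 := fun i => by
      simp only [bipyramid, PiLp.single_apply, Real.dist_eq, sq_abs, ← ht]
      split_ifs <;> ring
    have h2 : (if s then (1 : ℝ) else -1) ^ 2 = 1 := by split_ifs <;> norm_num
    rw [Finset.sum_congr rfl fun i _ => h1 i, Finset.sum_add_distrib]
    simp only [Finset.sum_ite_eq', Finset.mem_univ, if_true, Finset.sum_const, Finset.card_univ,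
      Fintype.card_fin, nsmul_eq_mul]
    rw [ht]
    field_simp
    linear_combination (if s then (1 : ℝ) else -1) ^ 2 * hsq + (1 + (m : ℝ)) * h2
  rcases u with k | s <;> rcases v with l | s'
  · have hkl : k ≠ l := fun h => huv (by rw [h])
    rw [bipyramid, bipyramid, EuclideanSpace.dist_sq_eq]
    have h1 : ∀ i, dist ((EuclideanSpace.single k (1 : ℝ)).ofLp i)
        ((EuclideanSpace.single l (1 : ℝ)).ofLp i) ^ 2 =
        (if i = k then 1 else 0) + if i = l then 1 else 0 := fun i => by
      simp only [PiLp.single_apply, Real.dist_eq, sq_abs]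
      split_ifs with h1 h2 <;> first | (exact absurd (h1.symm.trans h2) hkl) | norm_num
    rw [Finset.sum_congr rfl fun i _ => h1 i, Finset.sum_add_distrib]
    norm_num
  · exact hmix k s'
  · rw [dist_comm]; exact hmix l s
  · simp at hne

theorem dist_sq_bipyramid_apexes {m : ℕ} (hm : m ≠ 0) :
    2 < dist (bipyramid m (.inr true)) (bipyramid m (.inr false)) ^ 2 := by
  have hm' : 0 < (m : ℝ) := Nat.cast_pos.2 (Nat.pos_of_ne_zero hm)
  have hsq : √(1 + m) ^ 2 = 1 + (m : ℝ) := Real.sq_sqrt (by positivity)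
  rw [EuclideanSpace.dist_sq_eq]
  have h1 : ∀ i : Fin m, dist ((bipyramid m (.inr true)).ofLp i)
      ((bipyramid m (.inr false)).ofLp i) ^ 2 = 4 * (1 + m) / m ^ 2 := fun i => by
    simp only [bipyramid, Real.dist_eq, sq_abs]
    field_simp
    simp
    linear_combination 4 * hsq
  rw [Finset.sum_congr rfl fun i _ => h1 i, Finset.sum_const, Finset.card_univ, Fintype.card_fin,
    nsmul_eq_mul, mul_div_assoc', lt_div_iff₀ (by positivity)]
  nlinarith

theorem eq_zero_of_bipyramid_dependency {m : ℕ} (hm : m ≠ 0) {x : Fin m ⊕ Bool → ℝ}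
    (hsum : ∑ u, x u = 0) (hdep : ∑ u, x u • bipyramid m u = 0) (hzero : ∃ u, x u = 0) : x = 0 := by
  have hm' : (m : ℝ) ≠ 0 := Nat.cast_ne_zero.2 hm
  have hr : 0 < √(1 + m) := Real.sqrt_pos.2 (by positivity)
  have hcoord : ∀ k : Fin m, x (.inl k) = -((x (.inr true) * ((1 + √(1 + m)) / m) +
      x (.inr false) * ((1 - √(1 + m)) / m))) := fun k => by
    have := congrArg (fun z : EuclideanSpace ℝ (Fin m) => z k) hdep
    simp [Fintype.sum_sum_type, bipyramid, Pi.single_apply] at this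
    linear_combination this
  have hap : x (.inr true) = x (.inr false) := by
    rw [Fintype.sum_sum_type, Finset.sum_congr rfl fun k _ => hcoord k] at hsum
    simp only [Finset.sum_const, Finset.card_univ, Fintype.card_fin, nsmul_eq_mul,
      Fintype.sum_bool] at hsum
    field_simp at hsum
    have h1 : √(1 + m) * (x (.inr true) - x (.inr false)) = 0 := by linear_combination -hsum
    exact sub_eq_zero.1 ((mul_eq_zero.1 h1).resolve_left hr.ne')
  have hcoord' : ∀ k : Fin m, x (.inl k) = -(2 / m) * x (.inr false) := fun k => by
    rw [hcoord, hap]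
    field_simp
    ring
  have h0 : x (.inr false) = 0 := by
    obtain ⟨u, hu⟩ := hzero
    rcases u with k | _ | _
    · rw [hcoord' k] at hu
      exact (mul_eq_zero.1 hu).resolve_left (by simpa using hm)
    · exact hu
    · rw [← hap]; exact hu
  ext u
  rcases u with k | _ | _
  · rw [hcoord', h0]; simp
  · exact h0
  · rw [hap]; exact h0

/-- The vertices of the bipyramid, labelled so that two given labels are the apexes. -/
theorem exists_bipyramid {m : ℕ} (hm : m ≠ 0) {a b : Fin (m + 2)} (hab : a ≠ b) :
    ∃ p : Fin (m + 2) → EuclideanSpace ℝ (Fin m), HasOnlyFullDependencies p ∧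
      (∀ i j, i ≠ j → ¬(i = a ∧ j = b) → ¬(i = b ∧ j = a) → dist (p i) (p j) ^ 2 = 2) ∧
      2 < dist (p a) (p b) ^ 2 := by
  obtain ⟨σ, ha, hb⟩ : ∃ σ : Fin (m + 2) ≃ Fin m ⊕ Bool, σ a = .inr true ∧ σ b = .inr false := by
    let σ₀ : Fin (m + 2) ≃ Fin m ⊕ Bool := Fintype.equivOfCardEq (by simp)
    let σ₁ := σ₀.trans (Equiv.swap (σ₀ a) (.inr true))
    have h1 : σ₁ a = .inr true := by simp [σ₁]
    have h2 : σ₁ b ≠ .inr true := fun h => hab (σ₁.injective (h1.trans h.symm))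
    refine ⟨σ₁.trans (Equiv.swap (σ₁ b) (.inr false)), ?_, by simp⟩
    rw [Equiv.trans_apply, h1]
    exact Equiv.swap_apply_of_ne_of_ne h2.symm (by simp)
  refine ⟨fun i => bipyramid m (σ i), fun x h1 h2 ⟨k, hk⟩ => ?_, fun i j hij hab' hba' => ?_, ?_⟩
  · have := eq_zero_of_bipyramid_dependency hm (x := x ∘ σ.symm)
      (by rw [← h1]; exact Equiv.sum_comp σ.symm x)
      (by
        rw [← h2, ← Equiv.sum_comp σ]
        simp) ⟨σ k, by simpa using hk⟩
    ext i
    simpa using congrFun this (σ i)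
  · refine dist_sq_bipyramid hm _ _ (σ.injective.ne hij) ?_
    by_contra! h
    have key : ∀ i, ¬ (σ i).isLeft → i = a ∨ i = b := fun i hi => by
      rcases hσ : σ i with k | _ | _
      · simp [hσ] at hi
      · exact Or.inr (σ.injective (hσ.trans hb.symm))
      · exact Or.inl (σ.injective (hσ.trans ha.symm))
    have hi := key i (by simpa using h.1)
    have hj := key j (by simpa using h.2)
    grind
  · simp only [ha, hb]
    exact dist_sq_bipyramid_apexes hm

/-! ### Upper bounds -/

/-- The number of pairs below a given one; it represents a total preorder on the pairs. -/
noncomputable def pairRank {n : ℕ} (r : DistPair n → DistPair n → Prop) (e : DistPair n) : ℝ :=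
  {f | r f e}.ncard

theorem pairRank_le_iff {n : ℕ} {r : DistPair n → DistPair n → Prop} [IsPreorder (DistPair n) r]
    [Std.Total r] (e f : DistPair n) : pairRank r e ≤ pairRank r f ↔ r e f := by
  unfold pairRank
  rw [Nat.cast_le]
  refine ⟨fun h => ?_, fun h => Set.ncard_le_ncard (fun g hg => _root_.trans hg h)⟩
  by_contra hef
  have hfe : r f e := (Std.Total.total (r := r) e f).resolve_left hef
  refine h.not_gt (Set.ncard_lt_ncard ?_)
  exact ⟨fun g hg => _root_.trans hg hfe, fun hsub => hef (hsub (refl_of r e))⟩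

theorem pairDist_le_iff_sq {n d : ℕ} (p : Fin n → EuclideanSpace ℝ (Fin d)) (e f : DistPair n) :
    pairDist p e ≤ pairDist p f ↔ pairDist p e ^ 2 ≤ pairDist p f ^ 2 :=
  (pow_le_pow_iff_left₀ dist_nonneg dist_nonneg two_ne_zero).symm

/-- Every total preorder on the pairs of `m + 1` points is induced near a regular simplex. -/
theorem exists_induces_preorder {m : ℕ} (hm : 2 ≤ m)
    (r : DistPair (m + 1) → DistPair (m + 1) → Prop) [IsPreorder (DistPair (m + 1)) r]
    [Std.Total r] :
    ∃ p : Fin (m + 1) → EuclideanSpace ℝ (Fin m), InGeneralPosition p ∧ Induces p r := by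
  obtain ⟨q, hq, hdist, -⟩ := exists_bipyramid (m := m) (by omega)
    (a := 0) (b := Fin.last (m + 1)) (by simp [Fin.ext_iff])
  -- Leaving out one apex of the bipyramid leaves a regular simplex.
  set p₀ : Fin (m + 1) → EuclideanSpace ℝ (Fin m) := fun i => q i.castSucc
  have hdep : ∀ x : Fin (m + 1) → ℝ, ∑ i, x i = 0 → ∑ i, x i • p₀ i = 0 → x = 0 := by
    intro x h1 h2
    have := hq (Fin.snoc x 0) (by simp [Fin.sum_univ_castSucc, h1])
      (by simpa [Fin.sum_univ_castSucc] using h2) ⟨Fin.last _, by simp⟩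
    ext i
    simpa using congrFun this i.castSucc
  have hGP : InGeneralPosition p₀ :=
    ⟨HasOnlyFullDependencies.injective (by omega) fun x h1 h2 _ => hdep x h1 h2,
      fun s _ => affineIndependent_of_forall_dependency fun x h1 h2 _ => hdep x h1 h2⟩
  obtain ⟨p, hp, ε, hε, s, hps⟩ := exists_perturbation p₀ 0 0 2 (fun e => by
      have h1 := hdist e.1.1.castSucc e.1.2.castSucc (by simpa using e.2.ne)
        (fun h => (Fin.castSucc_lt_last _).ne h.2) (fun h => (Fin.castSucc_lt_last _).ne h.1)
      simpa [pairDist, p₀] using h1)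
    (fun w _ hw => funext fun e => by
      have := congrFun (hdep _ (sum_stressMatrix w e.1.1) (sum_stressMatrix_smul hw e.1.1)) e.1.2
      rw [stressMatrix_apply] at this
      simpa using this)
    ((isOpen_setOf_inGeneralPosition _ _).mem_nhds hGP) (pairRank r)
  refine ⟨p, hp, fun e f => ?_⟩
  have he := hps e
  have hf := hps f
  simp only [Pi.zero_apply, mul_zero, add_zero] at he hf
  rw [pairDist_le_iff_sq, he, hf, add_le_add_iff_left, mul_le_mul_iff_right₀ hε, pairRank_le_iff]

/-- Every linear order on the pairs of `m + 2` points is induced near a bipyramid whose apexes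
carry the greatest pair. -/
theorem exists_induces_linearOrder {m : ℕ} (hm : m ≠ 0)
    (r : DistPair (m + 2) → DistPair (m + 2) → Prop) [IsLinearOrder (DistPair (m + 2)) r] :
    ∃ p : Fin (m + 2) → EuclideanSpace ℝ (Fin m), InGeneralPosition p ∧ Induces p r := by
  have : Nonempty (DistPair (m + 2)) := ⟨⟨(0, Fin.last _), by simp [Fin.lt_def]⟩⟩
  obtain ⟨top, htop⟩ := Finite.exists_max (pairRank r)
  simp only [pairRank_le_iff] at htop
  obtain ⟨p₀, hdep, hdist, hapex⟩ := exists_bipyramid hm top.2.ne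
  have hdist' : ∀ e : DistPair (m + 2), e ≠ top → pairDist p₀ e ^ 2 = 2 := fun e he => by
    refine hdist _ _ e.2.ne (fun h => he (Subtype.ext (Prod.ext h.1 h.2))) fun h => ?_
    have h1 := e.2
    rw [h.1, h.2] at h1
    exact h1.not_gt top.2
  have hlt : {p : Fin (m + 2) → EuclideanSpace ℝ (Fin m) |
      ∀ e, e ≠ top → pairDist p e < pairDist p top} ∈ nhds p₀ := by
    refine IsOpen.mem_nhds ?_ fun e he => ?_
    · simp only [Set.ofPred_forall]
      refine isOpen_iInter_of_finite fun e => isOpen_iInter_of_finite fun _ => ?_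
      unfold pairDist
      exact isOpen_lt (by fun_prop) (by fun_prop)
    · refine lt_of_pow_lt_pow_left₀ 2 dist_nonneg ?_
      rw [hdist' e he]
      exact hapex
  obtain ⟨p, ⟨hGP, hptop⟩, ε, hε, s, hps⟩ := exists_perturbation p₀ (Pi.single top 1)
    (2 - pairDist p₀ top ^ 2) 2 (fun e => by
      rcases eq_or_ne e top with rfl | he
      · simp
      · simp [he, hdist' e he])
    (fun w hw hstress => by
      have hw0 : w top = 0 := by simpa [Pi.single_apply] using hw
      have hrow : ∀ k, (∃ l, stressMatrix w k l = 0) → stressMatrix w k = 0 := fun k hk =>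
        hdep _ (sum_stressMatrix w k) (sum_stressMatrix_smul hstress k) hk
      have h1 := hrow top.1.1 ⟨top.1.2, by rw [stressMatrix_apply, hw0, neg_zero]⟩
      funext e
      have h2 := hrow e.1.1 ⟨top.1.1, by rw [stressMatrix_comm, h1]; rfl⟩
      have h3 := stressMatrix_apply w e
      rw [h2] at h3
      simpa using h3.symm)
    (Filter.inter_mem ((isOpen_setOf_inGeneralPosition _ _).mem_nhds
      (hdep.inGeneralPosition (by omega) rfl)) hlt) (pairRank r)
  refine ⟨p, hGP, fun e f => ?_⟩
  rcases eq_or_ne f top with rfl | hf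
  · refine iff_of_true (htop e) ?_
    rcases eq_or_ne e f with rfl | he
    · exact le_rfl
    · exact (hptop e he).le
  rcases eq_or_ne e top with rfl | he
  · exact iff_of_false (fun h => hf (antisymm_of r (htop f) h)) (hptop f hf).not_ge
  have he' := hps e
  have hf' := hps f
  simp only [Pi.single_eq_of_ne he, Pi.single_eq_of_ne hf, mul_zero, add_zero] at he' hf'
  rw [pairDist_le_iff_sq, he', hf', add_le_add_iff_left, mul_le_mul_iff_right₀ hε, pairRank_le_iff]

/-! ### The least dimensions -/

theorem theorem1 (n : ℕ) (hn : 3 ≤ n) :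
    -- linear orders, induced by pairwise distinct points
    IsLeast {d : ℕ | ∀ r : DistPair n → DistPair n → Prop, IsLinearOrder (DistPair n) r →
      ∃ p : Fin n → EuclideanSpace ℝ (Fin d), Function.Injective p ∧ Induces p r} (n - 2) ∧
    -- linear orders, induced by points in general position
    IsLeast {d : ℕ | ∀ r : DistPair n → DistPair n → Prop, IsLinearOrder (DistPair n) r →
      ∃ p : Fin n → EuclideanSpace ℝ (Fin d), InGeneralPosition p ∧ Induces p r} (n - 2) ∧
    -- total preorders, induced by pairwise distinct points
    IsLeast {d : ℕ | ∀ r : DistPair n → DistPair n → Prop, IsPreorder (DistPair n) r → Std.Total r →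
      ∃ p : Fin n → EuclideanSpace ℝ (Fin d), Function.Injective p ∧ Induces p r} (n - 1) ∧
    -- total preorders, induced by points in general position
    IsLeast {d : ℕ | ∀ r : DistPair n → DistPair n → Prop, IsPreorder (DistPair n) r → Std.Total r →
      ∃ p : Fin n → EuclideanSpace ℝ (Fin d), InGeneralPosition p ∧ Induces p r} (n - 1) := by
  have hlin : ∀ r : DistPair n → DistPair n → Prop, IsLinearOrder (DistPair n) r →
      ∃ p : Fin n → EuclideanSpace ℝ (Fin (n - 2)), InGeneralPosition p ∧ Induces p r := by
    obtain ⟨m, rfl⟩ : ∃ m, n = m + 2 := ⟨n - 2, by omega⟩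
    exact fun r _ => exists_induces_linearOrder (by omega) r
  have hpre : ∀ r : DistPair n → DistPair n → Prop, IsPreorder (DistPair n) r → Std.Total r →
      ∃ p : Fin n → EuclideanSpace ℝ (Fin (n - 1)), InGeneralPosition p ∧ Induces p r := by
    obtain ⟨m, rfl⟩ : ∃ m, n = m + 1 := ⟨n - 1, by omega⟩
    exact fun r _ _ => exists_induces_preorder (by omega) r
  have hlin_lower : ∀ d : ℕ, d < n - 2 → ∀ p : Fin n → EuclideanSpace ℝ (Fin d),
      ¬ Induces p (nestedOrder n) := fun d hd p => not_induces_nestedOrder (by omega) p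
  have hpre_lower : ∀ d : ℕ, d < n - 1 → ∀ p : Fin n → EuclideanSpace ℝ (Fin d),
      Function.Injective p → ¬ Induces p (fun _ _ => True) :=
    fun d hd p hp => not_induces_true (by omega) hp
  have htrue : IsPreorder (DistPair n) (fun _ _ => True) :=
    { refl := fun _ => trivial, trans := fun _ _ _ _ _ => trivial }
  have htotal : Std.Total (fun _ _ : DistPair n => True) := ⟨fun _ _ => Or.inl trivial⟩
  refine ⟨⟨fun r hr => ?_, fun d hd => ?_⟩, ⟨hlin, fun d hd => ?_⟩,
    ⟨fun r hr ht => ?_, fun d hd => ?_⟩, ⟨hpre, fun d hd => ?_⟩⟩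
  · obtain ⟨p, hp, h⟩ := hlin r hr
    exact ⟨p, hp.1, h⟩
  · by_contra! hlt
    obtain ⟨p, -, h⟩ := hd _ (isLinearOrder_nestedOrder n)
    exact hlin_lower d hlt p h
  · by_contra! hlt
    obtain ⟨p, -, h⟩ := hd _ (isLinearOrder_nestedOrder n)
    exact hlin_lower d hlt p h
  · obtain ⟨p, hp, h⟩ := hpre r hr ht
    exact ⟨p, hp.1, h⟩
  · by_contra! hlt
    obtain ⟨p, hp, h⟩ := hd _ htrue htotal
    exact hpre_lower d hlt p hp h
  · by_contra! hlt
    obtain ⟨p, hp, h⟩ := hd _ htrue htotal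
    exact hpre_lower d hlt p hp.1 h
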